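/- **Setting.** A *$k$-unicast instance* $\mathcal M=(G,\mathcal S)$ consists of a finite connected undirected graph $G=(V,E)$ with edge capacities $c_e\ge 0$ and sessions $(s_i,t_i,d_i)$, $i\in[k]$, with source $s_i\in V$, sink $t_i\in V$ and demand $d_i>0$. *Coding protocols.* Each edge $\{u,v\}$ of $G$ is regarded as two arcs $(u,v),(v,u)$, each of capacity $c_{\{u,v\}}$. The messages $m_1,\dots,m_k$ are independent discrete random variables with Shannon entropy $H(m_i)\ge d_i$ (in bits). A *network coding protocol* with $R$ rounds assigns to every arc $a$ and round $1\le r\le R$ a function $f_{a,r}$ of $(m_1,\dots,m_k)$ with values in some alphabet such that $H(f_{a,r})\le c_a$ and, for $a=(u,v)$, $H(f_{a,r}\mid Y_{u,r})=0$, where the history $Y_{u,r}$ consists of the messages $m_i$ with $s_i=u$ and of all $f_{(x,u),r'}$ with $r'<r$. It has *completion times* $(T_1,\dots,T_k)\in\mathbb Z_{\ge0}^k$ if $H(m_i\mid Y_{t_i,T_i+1})=0$ for every $i$; its *makespan* is then $\max_i T_i$. *Hop-bounded concurrent flow.* For real $T\ge0$ let $\mathcal P_i(T)$ be the set of simple paths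 from $s_i$ to $t_i$ in $G$ with at most $T$ edges. $\textsc{ConcurrentFlow}_{\mathcal M}(T)$ is the linear program that maximizes $z$ over $z\in\mathbb R$ and $f_i(p)\ge0$ ($i\in[k]$, $p\in\mathcal P_i(T)$) subject to $$\sum_{p\in\mathcal P_i(T)}f_i(p)\ge z\,d_i\quad(i\in[k]),\qquad \sum_{i\in[k]}\ \sum_{p\in\mathcal P_i(T):\,e\in p}f_i(p)\le T\,c_e\quad(e\in E).$$ **Lemma.** There is a universal constant $C>0$ such that for every $k\ge2$, every $k$-unicast instance $\mathcal M$ and every real $T\ge0$: if the optimal value of $\textsc{ConcurrentFlow}_{\mathcal M}(T)$ is at most $1/10$, then every network coding protocol for $\mathcal M$ has makespan at least $$\frac{T}{C\cdot\log k\cdot\log\bigl(\sum_{i}d_i/\min_i d_i\bigr)}.$$ -/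

import Mathlib

open scoped ENNReal

universe u v w

noncomputable section

namespace NetworkCoding

/-! ### Entropy of discrete random variables -/

/-- Shannon entropy in bits, `H(X) = ∑ x, p(x) * log₂ (1 / p(x))`, of a random variable `X` on a
discrete probability space. It is a sum of nonnegative terms, with values in `[0, ∞]`. -/
def entropy {Ω : Type u} {α : Type v} (P : PMF Ω) (X : Ω → α) : ℝ≥0∞ :=
  ∑' x, ENNReal.ofReal (((P.map X) x).toReal * Real.logb 2 (1 / ((P.map X) x).toReal))

/-- Conditional Shannon entropy in bits,
`H(X | Y) = ∑ (x, y), p(x, y) * log₂ (p(y) / p(x, y))`. -/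
def condEntropy {Ω : Type u} {α : Type v} {β : Type w} (P : PMF Ω) (X : Ω → α) (Y : Ω → β) :
    ℝ≥0∞ :=
  ∑' q : α × β,
    ENNReal.ofReal (((P.map fun ω => (X ω, Y ω)) q).toReal *
      Real.logb 2 (((P.map Y) q.2).toReal / ((P.map fun ω => (X ω, Y ω)) q).toReal))

theorem tsum_prod_eq_one {k : ℕ} {A : Fin k → Type u} (p : ∀ i, PMF (A i)) :
    ∑' m : (∀ i, A i), ∏ i, p i (m i) = 1 := by
  induction k with
  | zero => simp
  | succ n ih =>
    rw [← (Fin.consEquiv A).tsum_eq, ENNReal.tsum_prod']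
    simp only [Fin.consEquiv_apply, Fin.prod_univ_succ, Fin.cons_zero, Fin.cons_succ,
      ENNReal.tsum_mul_left]
    rw [ih (fun i => p i.succ)]
    simp

/-- The joint law of independent random variables with laws `p i`. -/
def jointLaw {k : ℕ} {A : Fin k → Type u} (p : ∀ i, PMF (A i)) : PMF (∀ i, A i) :=
  ⟨fun m => ∏ i, p i (m i), tsum_prod_eq_one p ▸ ENNReal.summable.hasSum⟩

/-! ### Multiple-unicast instances and the hop-bounded concurrent flow LP -/

/-- A `k`-unicast instance: a connected undirected network with edge capacities, and `k` sessions,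
the `i`-th consisting of a source, a sink and a demand. -/
structure UnicastInstance (V : Type u) (k : ℕ) where
  graph : SimpleGraph V
  connected : graph.Connected
  capacity : graph.edgeSet → ℝ
  capacity_nonneg : ∀ e, 0 ≤ capacity e
  source : Fin k → V
  sink : Fin k → V
  demand : Fin k → ℝ
  demand_pos : ∀ i, 0 < demand i

namespace UnicastInstance

variable {V : Type u} {k : ℕ}

open Classical in
/-- The set `𝒫ᵢ(T)` of simple paths from the `i`-th source to the `i`-th sink with at most `T`
hops. -/
def hopPaths [Fintype V] (M : UnicastInstance V k) (T : ℝ) (i : Fin k) :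
    Finset (M.graph.Path (M.source i) (M.sink i)) :=
  Finset.univ.filter fun p => (p.1.length : ℝ) ≤ T

open Classical in
/-- `(z, f)` is a feasible solution of the linear program `ConcurrentFlow_M(T)`. Only the values
of `f i` on `𝒫ᵢ(T)` matter. -/
def IsConcurrentFlow [Fintype V] (M : UnicastInstance V k) (T : ℝ) (z : ℝ)
    (f : ∀ i, M.graph.Path (M.source i) (M.sink i) → ℝ) : Prop :=
  (∀ i, z * M.demand i ≤ ∑ p ∈ M.hopPaths T i, f i p) ∧
  (∀ e : M.graph.edgeSet,
    ∑ i, ∑ p ∈ M.hopPaths T i with (e : Sym2 V) ∈ p.1.edges, f i p ≤ T * M.capacity e) ∧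
  (∀ i, ∀ p ∈ M.hopPaths T i, 0 ≤ f i p)

/-- The optimal value of `ConcurrentFlow_M(T)`; it is `⊤` if the program is unbounded. -/
def concurrentFlowValue [Fintype V] (M : UnicastInstance V k) (T : ℝ) : EReal :=
  ⨆ (z : ℝ) (_ : ∃ f, M.IsConcurrentFlow T z f), (z : EReal)

/-! ### Network coding protocols -/

/-- Independent stochastic sources for the sessions; the message of session `i` has entropy at
least the demand of session `i`. -/
structure MessageSource (M : UnicastInstance V k) where
  Msg : Fin k → Type v
  law : ∀ i, PMF (Msg i)
  demand_le : ∀ i, ENNReal.ofReal (M.demand i) ≤ entropy (law i) id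

/-- What the node `x` knows after `τ` rounds: the messages originating at `x`, and everything
received in the first `τ` rounds along the arcs entering `x`. An undirected edge consists of two
opposite arcs (the darts of the graph). -/
def history (M : UnicastInstance V k) {A : Fin k → Type v} {Γ : Type w} {R : ℕ}
    (send : M.graph.Dart → Fin R → (∀ i, A i) → Γ) (x : V) (τ : ℕ) (m : ∀ i, A i) :
    (∀ i : {i : Fin k // M.source i = x}, A i) ×
      ({a : M.graph.Dart // a.snd = x} → {r : Fin R // (r : ℕ) < τ} → Γ) :=
  (fun i => m i, fun a r => send a r m)

/-- A network coding protocol: `send a r m` is the packet sent along the arc `a` in the round with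
(zero-based) index `r` when the messages are `m`. -/
structure CodingProtocol (M : UnicastInstance V k) (S : MessageSource.{u, v} M) where
  Γ : Type w
  rounds : ℕ
  send : M.graph.Dart → Fin rounds → (∀ i, S.Msg i) → Γ
  entropy_le : ∀ a r,
    entropy (jointLaw S.law) (send a r) ≤ ENNReal.ofReal (M.capacity ⟨a.edge, a.edge_mem⟩)
  causal : ∀ a r, condEntropy (jointLaw S.law) (send a r) (M.history send a.fst r) = 0

/-- The protocol has completion times `τ`: after `τ i` rounds the sink of session `i` can determine
the message of session `i`. -/
def CodingProtocol.HasCompletionTimes {M : UnicastInstance V k} {S : MessageSource.{u, v} M}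
    (P : CodingProtocol.{u, v, w} M S) (τ : Fin k → ℕ) : Prop :=
  ∀ i, condEntropy (jointLaw S.law) (fun m => m i) (M.history P.send (M.sink i) (τ i)) = 0

end UnicastInstance

/-- The makespan `maxᵢ τᵢ` of a vector of completion times. -/
def makespan {k : ℕ} (τ : Fin k → ℕ) : ℕ := Finset.univ.sup τ

end NetworkCoding

end

noncomputable section
namespace NetworkCoding

/-! ### Entropy bounds -/

/-! The proof turns a small flow value into a moving cut: a cut in space-time that is crossed by few
packets, yet whose packets carry many messages.

By LP duality, a flow value below `1/9` gives edge lengths `l` and session weights `h` such that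
every short `i`-path has length at least `h i` and `T ∑ c l ≤ (1/9) ∑ d h`. Some level set `I = {i |
D ≤ h i}` retains `∑ d h` up to the factor `α = 1 + log (∑ d / min d)`. Adding `D / T` to every edge
length makes paths with more than `T` hops have length at least `D` too, so each session in `I` has
endpoints at distance at least `D`. Region growing followed by a directed cut of the clusters
(`exists_separated_sessions`) leaves `I' ⊆ I` with an eighth of the demand, all of whose sources are
at distance of order `D / log k` from all of its sinks.

Let `ρ` be a multiple of the distance to the sources of `I'`. If the makespan were too small, `ρ`
would exceed the completion time at each sink. A node `x` cannot learn anything about `I'` before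
time `ρ x` except through packets sent from `u` to `v` in a round `r` with `ρ u ≤ r` and `r + 1 < ρ
v` (`sum_demand_le_moving_cut`). The entropy of these packets is therefore at least the demand of
`I'`. An edge crosses in at most `2 θ l e` rounds per direction, where the extra length `D / T` is
absorbed by integrality (`card_crossing_rounds_le`), so the cut has capacity at most `8/9` of that
demand, a contradiction. -/

theorem tsum_map_mul {Ω : Type u} {α : Type v} (P : PMF Ω) (X : Ω → α) (g : α → ℝ≥0∞) :
    ∑' x, P.map X x * g x = ∑' ω, P ω * g (X ω) := by
  classical
  simp only [PMF.map_apply, ← ENNReal.tsum_mul_right]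
  rw [ENNReal.tsum_comm]
  refine tsum_congr fun ω => ?_
  rw [tsum_eq_single (X ω)]
  · simp
  · intro x hx
    simp [hx]

theorem entropy_eq_tsum {Ω : Type u} {α : Type v} (P : PMF Ω) (X : Ω → α) :
    entropy P X =
      ∑' ω, P ω * ENNReal.ofReal (Real.logb 2 (1 / (P.map X (X ω)).toReal)) := by
  rw [← tsum_map_mul P X fun x => ENNReal.ofReal (Real.logb 2 (1 / (P.map X x).toReal))]
  refine tsum_congr fun x => ?_
  rw [ENNReal.ofReal_mul ENNReal.toReal_nonneg, ENNReal.ofReal_toReal (PMF.apply_ne_top _ _)]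

theorem le_map_apply {Ω : Type u} {α : Type v} (P : PMF Ω) (X : Ω → α) (ω : Ω) :
    P ω ≤ P.map X (X ω) := by
  classical
  rw [PMF.map_apply]
  refine le_trans ?_ (ENNReal.le_tsum ω)
  simp

/-- If `H(X | Y) = 0` then, almost surely, `X` is a function of `Y`. -/
theorem eq_of_condEntropy_eq_zero {Ω : Type u} {α : Type v} {β : Type w} {P : PMF Ω}
    {X : Ω → α} {Y : Ω → β} (h : condEntropy P X Y = 0) {m m' : Ω} (hm : P m ≠ 0)
    (hm' : P m' ≠ 0) (hY : Y m = Y m') : X m = X m' := by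
  classical
  by_contra hne
  have h1 := ENNReal.tsum_eq_zero.1 h (X m, Y m)
  have hpos : 0 < P.map (fun ω => (X ω, Y ω)) (X m, Y m) :=
    lt_of_lt_of_le (pos_iff_ne_zero.2 hm) (le_map_apply P (fun ω => (X ω, Y ω)) m)
  -- The mass of `m'` counts towards the value of `Y` but not towards the pair, so the logarithm in
  -- the summand is strictly positive.
  have hlt : P.map (fun ω => (X ω, Y ω)) (X m, Y m) < P.map Y (Y m) := by
    have hle : P.map (fun ω => (X ω, Y ω)) (X m, Y m) + P m' ≤ P.map Y (Y m) := by
      rw [PMF.map_apply, PMF.map_apply, ← tsum_ite_eq m' (fun _ => P m'), ← ENNReal.tsum_add]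
      refine ENNReal.tsum_le_tsum fun ω => ?_
      by_cases h2 : ω = m'
      · subst h2
        simp [hne, hY]
      · by_cases h3 : (X m, Y m) = (X ω, Y ω)
        · have h4 : Y m = Y ω := (Prod.ext_iff.1 h3).2
          rw [if_pos h3, if_neg h2, if_pos h4, add_zero]
        · simp [h2, h3]
    exact lt_of_lt_of_le (ENNReal.lt_add_right (PMF.apply_ne_top _ _) hm') hle
  rw [ENNReal.ofReal_eq_zero] at h1
  have hp : 0 < (P.map (fun ω => (X ω, Y ω)) (X m, Y m)).toReal :=
    ENNReal.toReal_pos hpos.ne' (PMF.apply_ne_top _ _)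
  have hq := (ENNReal.toReal_lt_toReal (PMF.apply_ne_top _ _) (PMF.apply_ne_top _ _)).2 hlt
  exact absurd h1 (not_le.2 (mul_pos hp (Real.logb_pos one_lt_two ((one_lt_div hp).2 hq))))

theorem tsum_prod_fin {k : ℕ} {A : Fin k → Type u} (f : ∀ i, A i → ℝ≥0∞) :
    ∑' m : (∀ i, A i), ∏ i, f i (m i) = ∏ i, ∑' x, f i x := by
  induction k with
  | zero => simp
  | succ n ih =>
    rw [← (Fin.consEquiv A).tsum_eq, ENNReal.tsum_prod']
    simp only [Fin.consEquiv_apply, Fin.prod_univ_succ, Fin.cons_zero, Fin.cons_succ,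
      ENNReal.tsum_mul_left, ENNReal.tsum_mul_right]
    rw [ih (fun i => f i.succ)]

theorem tsum_prod_fintype {ι : Type w} [Fintype ι] {A : ι → Type u} (f : ∀ i, A i → ℝ≥0∞) :
    ∑' m : (∀ i, A i), ∏ i, f i (m i) = ∏ i, ∑' x, f i x := by
  let e := (Fintype.equivFin ι).symm
  rw [← (Equiv.piCongrLeft A e).tsum_eq, ← Equiv.prod_comp e fun i => ∑' x, f i x,
    ← tsum_prod_fin fun j => f (e j)]
  refine tsum_congr fun m => ?_
  refine (Equiv.prod_comp e fun i => f i (Equiv.piCongrLeft A e m i)).symm.trans ?_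
  exact Finset.prod_congr rfl fun j _ => by rw [Equiv.piCongrLeft_apply_apply]

theorem jointLaw_apply {k : ℕ} {A : Fin k → Type u} (p : ∀ i, PMF (A i)) (m : ∀ i, A i) :
    jointLaw p m = ∏ i, p i (m i) := rfl

theorem map_eval_jointLaw {k : ℕ} {A : Fin k → Type u} (p : ∀ i, PMF (A i)) (i : Fin k) :
    (jointLaw p).map (fun m => m i) = p i := by
  classical
  ext x
  rw [PMF.map_apply]
  -- The guard is vacuous for `j ≠ i`, so the event `x = m i` becomes a product over coordinates.
  let f : ∀ j, A j → ℝ≥0∞ := fun j y => if ∀ h : j = i, x = h ▸ y then p j y else 0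
  have h1 : ∀ m : (∀ j, A j), (if x = m i then jointLaw p m else 0) = ∏ j, f j (m j) := by
    intro m
    split_ifs with hx
    · rw [jointLaw_apply]
      refine Finset.prod_congr rfl fun j _ => ?_
      simp only [f]
      rw [if_pos]
      rintro rfl
      exact hx
    · refine (Finset.prod_eq_zero (Finset.mem_univ i) ?_).symm
      simp [f, hx]
  rw [tsum_congr h1, tsum_prod_fin, Finset.prod_eq_single i]
  · rw [tsum_eq_single x]
    · simp [f]
    · intro y hy
      simp [f, Ne.symm hy]
  · intro j _ hj
    simp [f, hj]
  · simp

theorem entropy_eval_jointLaw {k : ℕ} {A : Fin k → Type u} (p : ∀ i, PMF (A i)) (i : Fin k) :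
    entropy (p i) id = entropy (jointLaw p) fun m => m i := by
  unfold entropy
  rw [PMF.map_id, map_eval_jointLaw]

theorem logb_one_div_prod {ι : Type*} (s : Finset ι) (p : ι → ℝ≥0∞) (h0 : ∀ i ∈ s, p i ≠ 0)
    (h1 : ∀ i ∈ s, p i ≤ 1) :
    ∑ i ∈ s, ENNReal.ofReal (Real.logb 2 (1 / (p i).toReal)) =
      ENNReal.ofReal (Real.logb 2 (1 / (∏ i ∈ s, p i).toReal)) := by
  have hp : ∀ i ∈ s, 0 < (p i).toReal := fun i hi =>
    ENNReal.toReal_pos (h0 i hi) (ne_top_of_le_ne_top ENNReal.one_ne_top (h1 i hi))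
  rw [← ENNReal.ofReal_sum_of_nonneg]
  · congr 1
    simp only [one_div, Real.logb_inv, ENNReal.toReal_prod]
    rw [Real.logb_prod _ _ fun i hi => (hp i hi).ne', Finset.sum_neg_distrib]
  · intro i hi
    refine Real.logb_nonneg one_lt_two ?_
    rw [one_le_div (hp i hi)]
    exact ENNReal.toReal_mono ENNReal.one_ne_top (h1 i hi)

/-- The pointwise form of the Gibbs inequality. -/
theorem gibbs_pointwise {x y z : ℝ≥0∞} (hy0 : y ≠ 0) (hz0 : z ≠ 0) (hx : x ≤ 1)
    (hy : y ≤ 1) (hz : z ≤ 1) :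
    x * y * ENNReal.ofReal (Real.logb 2 (1 / y.toReal)) +
        ENNReal.ofReal (1 / Real.log 2) * (x * y) ≤
      x * y * ENNReal.ofReal (Real.logb 2 (1 / z.toReal)) +
        ENNReal.ofReal (1 / Real.log 2) * (x * z) := by
  have ht : ∀ {a : ℝ≥0∞}, a ≤ 1 → a ≠ ⊤ := fun h => ne_top_of_le_ne_top ENNReal.one_ne_top h
  lift x to NNReal using ht hx
  lift y to NNReal using ht hy
  lift z to NNReal using ht hz
  have hy1 : (y : ℝ) ≤ 1 := by exact_mod_cast hy
  have hz1 : (z : ℝ) ≤ 1 := by exact_mod_cast hz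
  have hyp : 0 < (y : ℝ) := by
    have : y ≠ 0 := by exact_mod_cast hy0
    positivity
  have hzp : 0 < (z : ℝ) := by
    have : z ≠ 0 := by exact_mod_cast hz0
    positivity
  have hl2 : 0 < Real.log 2 := Real.log_pos one_lt_two
  have hly : 0 ≤ Real.logb 2 (1 / (y : ℝ)) :=
    Real.logb_nonneg one_lt_two ((one_le_div hyp).2 hy1)
  have hlz : 0 ≤ Real.logb 2 (1 / (z : ℝ)) :=
    Real.logb_nonneg one_lt_two ((one_le_div hzp).2 hz1)
  have hcast : ∀ a : NNReal, (a : ℝ≥0∞) = ENNReal.ofReal (a : ℝ) := fun a => by simp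
  simp only [ENNReal.coe_toReal]
  rw [hcast x, hcast y, hcast z]
  rw [← ENNReal.ofReal_mul (by positivity), ← ENNReal.ofReal_mul (by positivity),
    ← ENNReal.ofReal_mul (by positivity), ← ENNReal.ofReal_mul (by positivity),
    ← ENNReal.ofReal_mul (by positivity), ← ENNReal.ofReal_mul (by positivity),
    ← ENNReal.ofReal_add (by positivity) (by positivity),
    ← ENNReal.ofReal_add (by positivity) (by positivity)]
  refine ENNReal.ofReal_le_ofReal ?_
  have key : (y : ℝ) * (Real.log z - Real.log y) ≤ z - y := by
    rw [← Real.log_div hzp.ne' hyp.ne']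
    calc (y : ℝ) * Real.log (z / y) ≤ y * (z / y - 1) :=
          mul_le_mul_of_nonneg_left (Real.log_le_sub_one_of_pos (by positivity)) hyp.le
      _ = z - y := by field_simp
  simp only [Real.logb, one_div, Real.log_inv]
  rw [show (x : ℝ) * y * (-Real.log y / Real.log 2) + (Real.log 2)⁻¹ * (x * y) =
      x * (y * (-Real.log y) + y) / Real.log 2 by field_simp,
    show (x : ℝ) * y * (-Real.log z / Real.log 2) + (Real.log 2)⁻¹ * (x * z) =
      x * (y * (-Real.log z) + z) / Real.log 2 by field_simp]
  gcongr ?_ / _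
  refine mul_le_mul_of_nonneg_left ?_ x.2
  linarith

/-- If the independent messages outside `I` together with the random variables `W j` determine
all messages, then the messages in `I` have total entropy at most `∑ j, H(W j)`. -/
theorem sum_entropy_le_of_determined {k : ℕ} {A : Fin k → Type u} (p : ∀ i, PMF (A i))
    (I : Finset (Fin k)) {ι : Type v} [Fintype ι] {Γ : Type w} (W : ι → (∀ i, A i) → Γ)
    (hinj : ∀ m m', jointLaw p m ≠ 0 → jointLaw p m' ≠ 0 → (∀ i ∉ I, m i = m' i) →
      (∀ j, W j m = W j m') → m = m') :
    ∑ i ∈ I, entropy (p i) id ≤ ∑ j, entropy (jointLaw p) (W j) := by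
  classical
  set P := jointLaw p with hP
  set κ : ℝ≥0∞ := ENNReal.ofReal (1 / Real.log 2) with hκ
  let x : (∀ i, A i) → ℝ≥0∞ := fun m => ∏ i : {i // i ∉ I}, p i (m i)
  let y : (∀ i, A i) → ℝ≥0∞ := fun m => ∏ i ∈ I, p i (m i)
  let z : (∀ i, A i) → ℝ≥0∞ := fun m => ∏ j, P.map (W j) (W j m)
  have hxy : ∀ m, x m * y m = P m := by
    intro m
    simp only [x, y, hP, jointLaw_apply]
    rw [← Finset.prod_compl_mul_prod I]
    congr 1
    refine (Finset.prod_subtype Iᶜ (fun i => by simp) (fun i => p i (m i))).symm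
  have hinjsum : ∑' m, (if P m = 0 then 0 else x m * z m) ≤ 1 := by
    -- `F` is the product of the marginal laws, of total mass one. By `hinj`, summing `x m * z m`
    -- over the support of `P` visits each of its atoms at most once.
    let F : (∀ i : {i // i ∉ I}, A i) × (ι → Γ) → ℝ≥0∞ := fun q =>
      (∏ i : {i // i ∉ I}, p i (q.1 i)) * ∏ j, P.map (W j) (q.2 j)
    have hF : ∑' q, F q = 1 := by
      rw [ENNReal.tsum_prod']
      simp only [F, ENNReal.tsum_mul_left, ENNReal.tsum_mul_right]
      rw [tsum_prod_fintype (fun i : {i // i ∉ I} => (p i : A i → ℝ≥0∞)),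
        tsum_prod_fintype (fun j => (P.map (W j) : Γ → ℝ≥0∞))]
      simp only [PMF.tsum_coe, Finset.prod_const_one, mul_one]
    have hsup : ∀ m, (if P m = 0 then 0 else x m * z m) =
        Set.indicator {m | P m ≠ 0} (fun m => x m * z m) m := by
      intro m
      by_cases h : P m = 0 <;> simp [h]
    rw [tsum_congr hsup, ← tsum_subtype, ← hF]
    exact ENNReal.tsum_comp_le_tsum_of_injective
      (f := fun m : {m | P m ≠ 0} => ((fun i => m.1 i, fun j => W j m.1) :
        (∀ i : {i // i ∉ I}, A i) × (ι → Γ)))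
      (fun m m' h => Subtype.ext (hinj _ _ m.2 m'.2
        (fun i hi => congrFun (Prod.ext_iff.1 h).1 ⟨i, hi⟩)
        (fun j => congrFun (Prod.ext_iff.1 h).2 j))) F
  have hpt : ∀ m, P m * ∑ i ∈ I, ENNReal.ofReal (Real.logb 2 (1 / (p i (m i)).toReal)) + κ * P m ≤
      P m * (∑ j, ENNReal.ofReal (Real.logb 2 (1 / (P.map (W j) (W j m)).toReal))) +
        κ * (if P m = 0 then 0 else x m * z m) := by
    intro m
    by_cases hm : P m = 0
    · simp [hm]
    have hpm : ∀ i, p i (m i) ≠ 0 := by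
      intro i hi
      exact hm (by rw [hP, jointLaw_apply]; exact Finset.prod_eq_zero (Finset.mem_univ i) hi)
    have hqm : ∀ j, P.map (W j) (W j m) ≠ 0 := fun j h =>
      hm (le_antisymm (h ▸ le_map_apply P (W j) m) zero_le)
    rw [logb_one_div_prod I (fun i => p i (m i)) (fun i _ => hpm i)
        (fun i _ => PMF.coe_le_one _ _),
      logb_one_div_prod Finset.univ (fun j => P.map (W j) (W j m)) (fun j _ => hqm j)
        (fun i _ => PMF.coe_le_one _ _), if_neg hm, ← hxy m]
    exact gibbs_pointwise (Finset.prod_ne_zero_iff.2 fun i _ => hpm i)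
      (Finset.prod_ne_zero_iff.2 fun j _ => hqm j)
      (Finset.prod_le_one' fun i _ => PMF.coe_le_one _ _)
      (Finset.prod_le_one' fun i _ => PMF.coe_le_one _ _)
      (Finset.prod_le_one' fun i _ => PMF.coe_le_one _ _)
  have hsum := ENNReal.tsum_le_tsum hpt
  rw [ENNReal.tsum_add, ENNReal.tsum_add, ENNReal.tsum_mul_left, ENNReal.tsum_mul_left,
    PMF.tsum_coe, mul_one] at hsum
  have hL : ∑ i ∈ I, entropy (p i) id =
      ∑' m, P m * ∑ i ∈ I, ENNReal.ofReal (Real.logb 2 (1 / (p i (m i)).toReal)) := by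
    simp only [Finset.mul_sum]
    rw [Summable.tsum_finsetSum fun i _ => ENNReal.summable]
    refine Finset.sum_congr rfl fun i _ => ?_
    rw [entropy_eval_jointLaw, entropy_eq_tsum, map_eval_jointLaw]
  have hR : ∑ j, entropy P (W j) =
      ∑' m, P m * ∑ j, ENNReal.ofReal (Real.logb 2 (1 / (P.map (W j) (W j m)).toReal)) := by
    simp only [Finset.mul_sum]
    rw [Summable.tsum_finsetSum fun i _ => ENNReal.summable]
    exact Finset.sum_congr rfl fun j _ => entropy_eq_tsum P (W j)
  rw [hL, hR]
  -- Only the finite constant `κ` is cancelled, so infinite entropies need no separate treatment.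
  refine ENNReal.le_of_add_le_add_right (ENNReal.ofReal_ne_top (r := 1 / Real.log 2)) ?_
  refine hsum.trans (add_le_add_right ?_ _)
  calc _ ≤ κ * 1 := by gcongr
    _ = _ := mul_one _

/-! ### The moving cut bound for coding protocols -/

namespace UnicastInstance

/-- Let `ρ` be a potential on the vertices which is nonpositive at the sources of the sessions in
`I`, and greater than the completion time at the sinks. Then the packets that cross the space-time
cut `{(v, r) | ρ v ≤ r}` carry all the messages of the sessions in `I`. -/
theorem sum_demand_le_moving_cut {V : Type u} [Fintype V] {k : ℕ} {M : UnicastInstance V k}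
    {S : MessageSource.{u, v} M} (P : CodingProtocol.{u, v, w} M S) {τ : Fin k → ℕ}
    (hτ : P.HasCompletionTimes τ) [Fintype M.graph.Dart] (I : Finset (Fin k)) (ρ : V → ℝ)
    (hsource : ∀ i ∈ I, ρ (M.source i) ≤ 0) (hsink : ∀ i ∈ I, (τ i : ℝ) < ρ (M.sink i)) :
    ∑ i ∈ I, M.demand i ≤
      ∑ a : M.graph.Dart, M.capacity ⟨a.edge, a.edge_mem⟩ *
        (Finset.univ.filter fun r : Fin P.rounds =>
          ρ a.fst ≤ (r : ℕ) ∧ ((r : ℕ) : ℝ) + 1 < ρ a.snd).card := by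
  classical
  let ι := {q : M.graph.Dart × Fin P.rounds //
    ρ q.1.fst ≤ (q.2 : ℕ) ∧ ((q.2 : ℕ) : ℝ) + 1 < ρ q.1.snd}
  have hinj : ∀ m m', jointLaw S.law m ≠ 0 → jointLaw S.law m' ≠ 0 → (∀ i ∉ I, m i = m' i) →
      (∀ j : ι, P.send j.1.1 j.1.2 m = P.send j.1.1 j.1.2 m') → m = m' := by
    intro m m' hm hm' hI hW
    -- Before time `ρ x` the history at `x` is determined by the cut packets and the messages
    -- outside `I`. A packet received in round `s < r` either crosses the cut, or was sent from a
    -- node that had not yet reached its own potential at time `s`.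
    have hist : ∀ r : ℕ, ∀ x, (r : ℝ) < ρ x →
        M.history P.send x r m = M.history P.send x r m' := by
      intro r
      induction r using Nat.strong_induction_on with
      | _ r ih =>
        intro x hx
        refine Prod.ext ?_ ?_
        · funext i
          refine hI i fun hiI => ?_
          have := hsource i hiI
          rw [i.2] at this
          exact absurd (hx.trans_le this) (not_lt.2 (Nat.cast_nonneg r))
        · funext a s
          have hs : (((s : Fin P.rounds) : ℕ) : ℝ) + 1 ≤ r := by exact_mod_cast s.2
          by_cases hcut : ρ a.1.fst ≤ ((s : Fin P.rounds) : ℕ)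
          · exact hW ⟨(a.1, s.1), hcut, by rw [a.2]; linarith⟩
          · exact eq_of_condEntropy_eq_zero (P.causal a.1 s.1) hm hm'
              (ih _ s.2 _ (not_le.1 hcut))
    funext i
    by_cases hi : i ∈ I
    · exact eq_of_condEntropy_eq_zero (hτ i) hm hm' (hist _ _ (hsink i hi))
    · exact hI i hi
  have hent := sum_entropy_le_of_determined S.law I
    (fun j : ι => P.send j.1.1 j.1.2) hinj
  have hreal : ENNReal.ofReal (∑ i ∈ I, M.demand i) ≤
      ENNReal.ofReal (∑ j : ι, M.capacity ⟨j.1.1.edge, j.1.1.edge_mem⟩) := by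
    rw [ENNReal.ofReal_sum_of_nonneg fun i _ => (M.demand_pos i).le,
      ENNReal.ofReal_sum_of_nonneg fun i _ => M.capacity_nonneg _]
    exact (Finset.sum_le_sum fun i _ => S.demand_le i).trans
      (hent.trans (Finset.sum_le_sum fun j _ => P.entropy_le _ _))
  rw [ENNReal.ofReal_le_ofReal_iff (Finset.sum_nonneg fun i _ => M.capacity_nonneg _)] at hreal
  refine hreal.trans (le_of_eq ?_)
  rw [← Finset.sum_subtype (Finset.univ.filter fun q : M.graph.Dart × Fin P.rounds =>
    ρ q.1.fst ≤ (q.2 : ℕ) ∧ ((q.2 : ℕ) : ℝ) + 1 < ρ q.1.snd) (by simp)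
    (fun q => M.capacity ⟨q.1.edge, q.1.edge_mem⟩), Finset.sum_filter, Fintype.sum_prod_type]
  refine Finset.sum_congr rfl fun a _ => ?_
  rw [← Finset.sum_filter, mul_comm, ← nsmul_eq_mul]
  exact Finset.sum_eq_card_nsmul fun r _ => rfl

end UnicastInstance

/-! ### Linear programming duality -/

/-- Theorem of the alternative for packing-covering systems with positive right-hand sides. -/
theorem exists_dual_of_infeasible_of_pos {ι E J : Type*} [Fintype ι] [Fintype E] [Fintype J]
    (B : J → ι → ℝ) (A : J → E → ℝ) (g : ι → ℝ) (b : E → ℝ)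
    (hg : ∀ i, 0 < g i) (hb : ∀ e, 0 < b e)
    (hinf : ¬ ∃ f : J → ℝ, (∀ j, 0 ≤ f j) ∧ (∀ i, g i ≤ ∑ j, f j * B j i) ∧
      ∀ e, ∑ j, f j * A j e ≤ b e) :
    ∃ (h : ι → ℝ) (l : E → ℝ), (∀ i, 0 ≤ h i) ∧ (∀ e, 0 ≤ l e) ∧
      (∀ j, ∑ i, B j i * h i ≤ ∑ e, A j e * l e) ∧
      ∑ e, b e * l e ≤ ∑ i, g i * h i ∧ 0 < ∑ i, g i * h i := by
  classical
  -- Strict inequalities make `Q` open, so the separation does not require the cone of attainable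
  -- vectors to be closed.
  let Q : Set ((ι → ℝ) × (E → ℝ)) := (Set.univ.pi fun i => Set.Ioi (g i)) ×ˢ
    (Set.univ.pi fun e => Set.Iio (b e))
  let L : (J → ℝ) →ₗ[ℝ] (ι → ℝ) × (E → ℝ) :=
    { toFun := fun f => (fun i => ∑ j, f j * B j i, fun e => ∑ j, f j * A j e)
      map_add' := by
        intro f f'
        ext <;> simp [add_mul, Finset.sum_add_distrib]
      map_smul' := by
        intro c f
        ext <;> simp [Finset.mul_sum, mul_assoc] }
  have hQo : IsOpen Q := (isOpen_set_pi Set.finite_univ fun i _ => isOpen_Ioi).prod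
    (isOpen_set_pi Set.finite_univ fun i _ => isOpen_Iio)
  have hQc : Convex ℝ Q := (convex_pi fun i _ => convex_Ioi _).prod
    (convex_pi fun i _ => convex_Iio _)
  have hFc : Convex ℝ (L '' Set.Ici 0) := (convex_Ici 0).linear_image L
  have hdisj : Disjoint Q (L '' Set.Ici 0) := by
    rw [Set.disjoint_left]
    rintro _ ⟨h1, h2⟩ ⟨f, hf, rfl⟩
    exact hinf ⟨f, hf, fun i => (h1 i trivial).le, fun e => (h2 e trivial).le⟩
  obtain ⟨φ, u, hφQ, hφF⟩ := geometric_hahn_banach_open hQc hQo hFc hdisj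
  let x : ι → ℝ := fun i => φ (Pi.single i 1, 0)
  let y : E → ℝ := fun e => φ (0, Pi.single e 1)
  have hφ : ∀ q : (ι → ℝ) × (E → ℝ), φ q = ∑ i, q.1 i * x i + ∑ e, q.2 e * y e := by
    intro q
    have hq : q = ∑ i, q.1 i • ((Pi.single i 1, 0) : (ι → ℝ) × (E → ℝ)) +
        ∑ e, q.2 e • ((0, Pi.single e 1) : (ι → ℝ) × (E → ℝ)) := by
      ext j
      · simp [Prod.fst_sum, Finset.sum_apply, Pi.single_apply]
      · simp [Prod.snd_sum, Finset.sum_apply, Pi.single_apply]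
    conv_lhs => rw [hq]
    simp only [map_add, map_sum, map_smul, smul_eq_mul, x, y]
  have hu : u ≤ 0 := by
    have := hφF 0 ⟨0, Set.self_mem_Ici, map_zero L⟩
    simpa using this
  have hQneg : ∀ q ∈ Q, φ q < 0 := fun q hq => (hφQ q hq).trans_le hu
  have hmem : ∀ s : ι → ℝ, ∀ t : E → ℝ, (∀ i, 0 < s i) → (∀ e, 0 < t e) →
      ∑ i, (g i + s i) * x i + ∑ e, (b e - t e) * y e < 0 := by
    intro s t hs ht
    have := hQneg (fun i => g i + s i, fun e => b e - t e)
      ⟨fun i _ => by simpa using hs i, fun e _ => by simpa using ht e⟩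
    rwa [hφ] at this
  have hnonpos_of : ∀ c d : ℝ, (∀ N : ℝ, 0 ≤ N → c + N * d < 0) → d ≤ 0 := by
    intro c d h
    by_contra hd
    push Not at hd
    have := h (|c| / d) (by positivity)
    rw [div_mul_cancel₀ _ hd.ne'] at this
    linarith [neg_abs_le c]
  have hx : ∀ i, x i ≤ 0 := by
    intro i
    refine hnonpos_of (∑ i, (g i + 1) * x i + ∑ e, (b e - 1) * y e) _ fun N hN => ?_
    have := hmem (fun j => 1 + N * (Pi.single i 1 : ι → ℝ) j) (fun _ => 1)
      (fun j => by
        have : 0 ≤ (Pi.single i 1 : ι → ℝ) j := by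
          rw [Pi.single_apply]; split_ifs <;> norm_num
        positivity) (fun _ => one_pos)
    convert this using 1
    have : ∀ j, (g j + (1 + N * (Pi.single i 1 : ι → ℝ) j)) * x j =
        (g j + 1) * x j + N * ((Pi.single i 1 : ι → ℝ) j * x j) := fun j => by ring
    simp only [this, Finset.sum_add_distrib, ← Finset.mul_sum]
    simp [Pi.single_apply]
    ring
  have hy : ∀ e, 0 ≤ y e := by
    intro e
    rw [← neg_nonpos]
    refine hnonpos_of (∑ i, (g i + 1) * x i + ∑ e, (b e - 1) * y e) _ fun N hN => ?_
    have := hmem (fun _ => 1) (fun j => 1 + N * (Pi.single e 1 : E → ℝ) j)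
      (fun _ => one_pos) (fun j => by
        have : 0 ≤ (Pi.single e 1 : E → ℝ) j := by
          rw [Pi.single_apply]; split_ifs <;> norm_num
        positivity)
    convert this using 1
    have : ∀ j, (b j - (1 + N * (Pi.single e 1 : E → ℝ) j)) * y j =
        (b j - 1) * y j - N * ((Pi.single e 1 : E → ℝ) j * y j) := fun j => by ring
    simp only [this, Finset.sum_sub_distrib, ← Finset.mul_sum]
    simp [Pi.single_apply]
    ring
  have hgb : ∑ i, g i * x i + ∑ e, b e * y e ≤ 0 := by
    by_contra hpos
    push Not at hpos
    set c := ∑ i, g i * x i + ∑ e, b e * y e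
    set d := ∑ i, x i - ∑ e, y e
    have hε : ∀ ε : ℝ, 0 < ε → c + ε * d < 0 := by
      intro ε hε
      have := hmem (fun _ => ε) (fun _ => ε) (fun _ => hε) (fun _ => hε)
      convert this using 1
      simp only [add_mul, sub_mul, Finset.sum_add_distrib, Finset.sum_sub_distrib,
        ← Finset.mul_sum, c, d]
      ring
    have h1 := hε (c / (1 + |d|)) (by positivity)
    have h2 : c / (1 + |d|) * d ≥ -c := by
      rw [ge_iff_le, div_mul_eq_mul_div, le_div_iff₀ (by positivity)]
      nlinarith [neg_abs_le d, abs_nonneg d]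
    linarith
  have hF : ∀ j, 0 ≤ ∑ i, B j i * x i + ∑ e, A j e * y e := by
    intro j
    have hj : ∀ N : ℝ, 0 ≤ N → u ≤ N * (∑ i, B j i * x i + ∑ e, A j e * y e) := by
      intro N hN
      have := hφF (L (N • Pi.single j 1)) ⟨_, by
        intro i
        have : 0 ≤ (Pi.single j 1 : J → ℝ) i := by
          rw [Pi.single_apply]; split_ifs <;> norm_num
        simpa using mul_nonneg hN this, rfl⟩
      rw [map_smul, map_smul, hφ] at this
      simpa [L, Pi.single_apply] using this
    have := hnonpos_of (u - 1) (-(∑ i, B j i * x i + ∑ e, A j e * y e)) fun N hN => by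
      linarith [hj N hN]
    linarith
  refine ⟨fun i => -x i, y, fun i => neg_nonneg.2 (hx i), hy, fun j => ?_, ?_, ?_⟩
  · have := hF j
    simp only [mul_neg, Finset.sum_neg_distrib]
    linarith
  · simp only [mul_neg, Finset.sum_neg_distrib]
    linarith
  · have h0 : 0 ≤ ∑ i, g i * -x i :=
      Finset.sum_nonneg fun i _ => mul_nonneg (hg i).le (neg_nonneg.2 (hx i))
    refine lt_of_le_of_ne h0 fun heq => ?_
    -- If the objective vanished, positivity of `g` and `b` would force `φ = 0`, although `φ` is
    -- negative on `Q`.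
    have hx0 : ∀ i, x i = 0 := by
      intro i
      have := (Finset.sum_eq_zero_iff_of_nonneg fun i _ =>
        mul_nonneg (hg i).le (neg_nonneg.2 (hx i))).1 heq.symm i (Finset.mem_univ i)
      simpa [(hg i).ne'] using this
    have hy0 : ∀ e, y e = 0 := by
      intro e
      have hle : ∑ e, b e * y e ≤ 0 := by simpa [hx0] using hgb
      have := (Finset.sum_eq_zero_iff_of_nonneg fun e _ => mul_nonneg (hb e).le (hy e)).1
        (le_antisymm hle (Finset.sum_nonneg fun e _ => mul_nonneg (hb e).le (hy e))) e
        (Finset.mem_univ e)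
      simpa [(hb e).ne'] using this
    have := hmem (fun _ => 1) (fun _ => 1) (fun _ => one_pos) (fun _ => one_pos)
    simp [hx0, hy0] at this

/-- Duality for packing-covering systems in which capacities may vanish: edges of capacity zero
are given a large length. -/
theorem exists_dual_of_infeasible {ι E J : Type*} [Fintype ι] [Fintype E] [Fintype J]
    (a : J → ι) (X : J → E → Prop) [DecidableEq ι] [∀ j e, Decidable (X j e)]
    (g : ι → ℝ) (b : E → ℝ) (hg : ∀ i, 0 < g i) (hb : ∀ e, 0 ≤ b e)
    (hinf : ¬ ∃ f : J → ℝ, (∀ j, 0 ≤ f j) ∧ (∀ i, g i ≤ ∑ j with a j = i, f j) ∧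
      ∀ e, ∑ j with X j e, f j ≤ b e) :
    ∃ (h : ι → ℝ) (l : E → ℝ), (∀ i, 0 ≤ h i) ∧ (∀ e, 0 ≤ l e) ∧
      (∀ j, h (a j) ≤ ∑ e with X j e, l e) ∧
      ∑ e, b e * l e ≤ ∑ i, g i * h i ∧ 0 < ∑ i, g i * h i := by
  classical
  -- Columns that use a zero-capacity edge are discarded and such capacities are raised to `1`.
  -- Afterwards these edges receive length `∑ i, h i`, which covers every discarded column and costs
  -- nothing.
  let good : J → Prop := fun j => ∀ e, X j e → b e ≠ 0
  obtain ⟨h, l, hh, hl, hj, hle, hpos⟩ := exists_dual_of_infeasible_of_pos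
    (fun j i => if a j = i ∧ good j then 1 else 0)
    (fun j e => if X j e ∧ good j then 1 else 0) g
    (fun e => if b e = 0 then 1 else b e) hg
    (fun e => by
      split_ifs with h0
      · exact one_pos
      · exact lt_of_le_of_ne (hb e) (Ne.symm h0)) (by
      rintro ⟨f, hf, h1, h2⟩
      refine hinf ⟨fun j => if good j then f j else 0, fun j => ?_, fun i => ?_, fun e => ?_⟩
      · dsimp only
        split_ifs
        exacts [hf j, le_rfl]
      · refine (h1 i).trans (le_of_eq ?_)
        rw [Finset.sum_filter]
        refine Finset.sum_congr rfl fun j _ => ?_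
        by_cases h3 : a j = i <;> by_cases h4 : good j <;> simp [h3, h4]
      · rw [Finset.sum_filter]
        by_cases h0 : b e = 0
        · rw [h0]
          refine le_of_eq (Finset.sum_eq_zero fun j _ => ?_)
          by_cases h3 : X j e
          · have : ¬ good j := fun h => h e h3 h0
            simp [this]
          · simp [h3]
        · have := h2 e
          rw [if_neg h0] at this
          refine le_trans (le_of_eq ?_) this
          refine Finset.sum_congr rfl fun j _ => ?_
          by_cases h3 : X j e <;> by_cases h4 : good j <;> simp [h3, h4])
  have hH : ∀ i, h i ≤ ∑ i, h i := fun i =>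
    Finset.single_le_sum (fun i _ => hh i) (Finset.mem_univ i)
  have hH0 : 0 ≤ ∑ i, h i := Finset.sum_nonneg fun i _ => hh i
  have hl' : ∀ e, 0 ≤ (if b e = 0 then ∑ i, h i else l e) := fun e => by
    split_ifs
    exacts [hH0, hl e]
  refine ⟨h, fun e => if b e = 0 then ∑ i, h i else l e, hh, hl', fun j => ?_, ?_, hpos⟩
  · by_cases hgood : good j
    · have := hj j
      simp only [hgood, and_true, ite_mul, one_mul, zero_mul] at this
      rw [Finset.sum_ite_eq Finset.univ (a j), if_pos (Finset.mem_univ _),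
        ← Finset.sum_filter] at this
      refine this.trans (le_of_eq (Finset.sum_congr rfl fun e he => ?_))
      simp [hgood e (Finset.mem_filter.1 he).2]
    · simp only [good, not_forall, not_not] at hgood
      obtain ⟨e, he, h0⟩ := hgood
      refine (hH (a j)).trans ?_
      have := Finset.single_le_sum (s := Finset.univ.filter (X j)) (fun e _ => hl' e)
        (Finset.mem_filter.2 ⟨Finset.mem_univ e, he⟩)
      simpa [h0] using this
  · refine le_trans (Finset.sum_le_sum fun e _ => ?_) hle
    by_cases h0 : b e = 0
    · simpa [h0] using hl e
    · simp [h0]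

/-- Duality for packing-covering systems whose columns are grouped by the constraint they cover. -/
theorem exists_dual_of_infeasible_of_groups {ι E : Type*} {Q : ι → Type*} [Fintype ι] [Fintype E]
    (S : ∀ i, Finset (Q i)) (X : ∀ i, Q i → E → Prop) [∀ i q e, Decidable (X i q e)]
    (g : ι → ℝ) (b : E → ℝ) (hg : ∀ i, 0 < g i) (hb : ∀ e, 0 ≤ b e)
    (hinf : ¬ ∃ f : ∀ i, Q i → ℝ, (∀ i, g i ≤ ∑ p ∈ S i, f i p) ∧
      (∀ e, ∑ i, ∑ p ∈ S i with X i p e, f i p ≤ b e) ∧ ∀ i, ∀ p ∈ S i, 0 ≤ f i p) :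
    ∃ (h : ι → ℝ) (l : E → ℝ), (∀ i, 0 ≤ h i) ∧ (∀ e, 0 ≤ l e) ∧
      (∀ i, ∀ p ∈ S i, h i ≤ ∑ e with X i p e, l e) ∧
      ∑ e, b e * l e ≤ ∑ i, g i * h i ∧ 0 < ∑ i, g i * h i := by
  classical
  obtain ⟨h, l, hh, hl, hj, hle, hpos⟩ := exists_dual_of_infeasible (J := Σ i, S i) (fun j => j.1)
    (fun j e => X j.1 j.2 e) g b hg hb (by
      rintro ⟨f, hf, h1, h2⟩
      obtain ⟨f', hf'⟩ : ∃ f' : ∀ i, Q i → ℝ, ∀ i (p : S i), f' i p = f ⟨i, p⟩ :=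
        ⟨fun i p => if hp : p ∈ S i then f ⟨i, p, hp⟩ else 0, fun i p => by simp⟩
      refine hinf ⟨f', fun i => ?_, fun e => ?_, fun i p hp => ?_⟩
      · refine (h1 i).trans (le_of_eq ?_)
        rw [Finset.sum_filter, Fintype.sum_sigma, Fintype.sum_eq_single i,
          ← Finset.sum_coe_sort (S i)]
        · refine Finset.sum_congr rfl fun p _ => ?_
          rw [if_pos rfl, hf']
        · exact fun j hji => Finset.sum_eq_zero fun p _ => if_neg hji
      · refine le_trans (le_of_eq ?_) (h2 e)
        rw [Finset.sum_filter, Fintype.sum_sigma]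
        refine Finset.sum_congr rfl fun i _ => ?_
        rw [Finset.sum_filter, ← Finset.sum_coe_sort]
        refine Finset.sum_congr rfl fun p _ => ?_
        rw [hf']
      · rw [hf' i ⟨p, hp⟩]
        exact hf _)
  exact ⟨h, l, hh, hl, fun i p hp => hj ⟨i, p, hp⟩, hle, hpos⟩

namespace UnicastInstance

/-- A dual solution of the hop-bounded concurrent flow program whose value is small. -/
theorem exists_dual_of_concurrentFlowValue_lt {V : Type u} [Fintype V] {k : ℕ}
    (M : UnicastInstance V k) [Fintype M.graph.edgeSet] [DecidableEq V] {T z : ℝ} (hT : 0 ≤ T)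
    (hz : 0 < z) (hval : M.concurrentFlowValue T < (z : EReal)) :
    ∃ (h : Fin k → ℝ) (l : M.graph.edgeSet → ℝ), (∀ i, 0 ≤ h i) ∧ (∀ e, 0 ≤ l e) ∧
      (∀ i, ∀ p : M.graph.Path (M.source i) (M.sink i), (p.1.length : ℝ) ≤ T →
        h i ≤ ∑ e : M.graph.edgeSet with e.1 ∈ p.1.edges, l e) ∧
      T * ∑ e, M.capacity e * l e ≤ z * ∑ i, M.demand i * h i ∧
      0 < ∑ i, M.demand i * h i := by
  classical
  obtain ⟨h, l, hh, hl, hj, hle, hpos⟩ := exists_dual_of_infeasible_of_groups (M.hopPaths T)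
    (fun i p (e : M.graph.edgeSet) => e.1 ∈ p.1.edges)
    (fun i => z * M.demand i) (fun e => T * M.capacity e)
    (fun i => mul_pos hz (M.demand_pos i)) (fun e => mul_nonneg hT (M.capacity_nonneg e)) (by
      rintro ⟨f, h1, h2, h3⟩
      refine absurd hval (not_lt.2 (le_iSup₂_of_le z ⟨f, h1, fun e => ?_, h3⟩ le_rfl))
      convert h2 e)
  simp only [mul_assoc, ← Finset.mul_sum] at hle hpos
  refine ⟨h, l, hh, hl, fun i p hp => ?_, hle, pos_of_mul_pos_right hpos hz.le⟩
  convert hj i p (by simpa [hopPaths] using hp)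

end UnicastInstance

/-! ### Selecting sessions -/

/-- With sessions added in decreasing order of `h`, a new one joining total demand `S` contributes
at most `B * d a / (d a + S)`, hence at most `B` times the increase of `log S`. The first session
contributes at most `B`, and the rest telescopes. -/
theorem sum_mul_le_of_threshold {ι : Type*} (d h : ι → ℝ) {c B : ℝ} (hc : 0 < c)
    (hd : ∀ i, c ≤ d i) (hh : ∀ i, 0 ≤ h i) (s : Finset ι) (hs : s.Nonempty)
    (hB : ∀ j ∈ s, h j * ∑ i ∈ s with h j ≤ h i, d i ≤ B) :
    ∑ i ∈ s, d i * h i ≤ B * (1 + Real.log ((∑ i ∈ s, d i) / c)) := by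
  classical
  induction s using Finset.induction_on_min_value h with
  | empty => exact absurd hs Finset.not_nonempty_empty
  | insert a s ha hmin ih =>
    have hda : 0 < d a := hc.trans_le (hd a)
    have hall : (insert a s).filter (fun i => h a ≤ h i) = insert a s := by
      rw [Finset.filter_eq_self]
      intro i hi
      rcases Finset.mem_insert.1 hi with rfl | hi
      exacts [le_rfl, hmin i hi]
    have hBa := hB a (Finset.mem_insert_self a s)
    rw [hall, Finset.sum_insert ha] at hBa
    have hS0 : 0 ≤ ∑ i ∈ s, d i := Finset.sum_nonneg fun i _ => (hc.trans_le (hd i)).le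
    have hB0 : 0 ≤ B := le_trans (mul_nonneg (hh a) (by positivity)) hBa
    rw [Finset.sum_insert ha, Finset.sum_insert ha]
    rcases s.eq_empty_or_nonempty with rfl | hne
    · simp only [Finset.sum_empty, add_zero] at hBa ⊢
      have : 0 ≤ Real.log (d a / c) := Real.log_nonneg ((one_le_div hc).2 (hd a))
      nlinarith [mul_nonneg hB0 this]
    · have hS : 0 < ∑ i ∈ s, d i := Finset.sum_pos (fun i _ => hc.trans_le (hd i)) hne
      have h1 := ih hne fun j hj => le_trans (mul_le_mul_of_nonneg_left
        (Finset.sum_le_sum_of_subset_of_nonneg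
          (Finset.filter_subset_filter _ (Finset.subset_insert a s))
          fun i _ _ => (hc.trans_le (hd i)).le) (hh j)) (hB j (Finset.mem_insert_of_mem hj))
      set S := ∑ i ∈ s, d i
      have hlog : d a / (d a + S) ≤ Real.log ((d a + S) / c) - Real.log (S / c) := by
        rw [← Real.log_div (by positivity) (by positivity)]
        have : (d a + S) / c / (S / c) = (d a + S) / S := by field_simp
        rw [this]
        refine le_trans (le_of_eq ?_) (Real.one_sub_inv_le_log_of_pos (by positivity))
        field_simp
        ring
      have h2 : d a * h a ≤ B * (d a / (d a + S)) := by
        rw [mul_div_assoc', le_div_iff₀ (by positivity)]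
        nlinarith
      nlinarith [mul_le_mul_of_nonneg_left hlog hB0]

/-- Some level set `{i | D ≤ h i}` captures a logarithmic fraction of `∑ i, d i * h i`. -/
theorem exists_threshold {ι : Type*} [Fintype ι] (d h : ι → ℝ) {c : ℝ} (hc : 0 < c)
    (hd : ∀ i, c ≤ d i) (hh : ∀ i, 0 ≤ h i) (hpos : 0 < ∑ i, d i * h i) :
    ∃ D, 0 < D ∧ ∑ i, d i * h i ≤
      D * (∑ i with D ≤ h i, d i) * (1 + Real.log ((∑ i, d i) / c)) := by
  have hne : (Finset.univ : Finset ι).Nonempty := by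
    by_contra h0
    rw [Finset.not_nonempty_iff_eq_empty] at h0
    simp [h0] at hpos
  obtain ⟨j, -, hj⟩ := Finset.exists_max_image Finset.univ
    (fun j => h j * ∑ i with h j ≤ h i, d i) hne
  have := sum_mul_le_of_threshold d h hc hd hh Finset.univ hne hj
  refine ⟨h j, lt_of_le_of_ne (hh j) fun h0 => ?_, this⟩
  rw [← h0, zero_mul, zero_mul] at this
  linarith

/-- Region growing: all but a small fraction of the weight can be covered by clusters of small
diameter that are far apart from each other. -/
theorem exists_separated_clusters {ι : Type*} (δ : ι → ι → ℝ)
    (hself : ∀ x, δ x x = 0) (hsymm : ∀ x y, δ x y = δ y x)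
    (htri : ∀ x y z, δ x z ≤ δ x y + δ y z) (w : ι → ℝ) (hw : ∀ x, 0 ≤ w x) {w₀ ε r W : ℝ}
    (hw₀ : 0 < w₀) (hε : 0 < ε) (hr : 0 ≤ r) (J : ℕ) (hJ : W + w₀ < (1 + ε) ^ J * w₀)
    (s : Finset ι) (hs : ∑ x ∈ s, w x ≤ W) :
    ∃ t ⊆ s, ∃ c : ι → ι, (∀ x ∈ t, c x ∈ s) ∧
      (∀ x ∈ t, ∀ y ∈ t, c x = c y → δ x y ≤ 2 * J * r) ∧
      (∀ x ∈ t, ∀ y ∈ t, c x ≠ c y → r < δ x y) ∧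
      ∑ x ∈ s, w x ≤ ∑ x ∈ t, w x + ε * (∑ x ∈ t, w x + s.card * w₀) := by
  classical
  induction s using Finset.strongInduction with
  | H s ih =>
    rcases s.eq_empty_or_nonempty with rfl | ⟨v, hv⟩
    · exact ⟨∅, subset_rfl, id, by simp⟩
    let ball : ℕ → Finset ι := fun j => s.filter fun x => δ v x ≤ j * r
    have hsub : ∀ j, ball j ⊆ s := fun j => Finset.filter_subset _ _
    -- Otherwise the seeded weight would grow by `1 + ε` in all `J` steps and exceed `W + w₀`. The
    -- seed `w₀` makes the starting value positive.
    obtain ⟨j, hjJ, hj⟩ : ∃ j < J, ∑ x ∈ ball (j + 1), w x + w₀ ≤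
        (1 + ε) * (∑ x ∈ ball j, w x + w₀) := by
      by_contra hcon
      push Not at hcon
      have hgrow : ∀ j ≤ J, (1 + ε) ^ j * w₀ ≤ ∑ x ∈ ball j, w x + w₀ := by
        intro j
        induction j with
        | zero =>
          intro _
          have : 0 ≤ ∑ x ∈ ball 0, w x := Finset.sum_nonneg fun x _ => hw x
          simpa using this
        | succ j ihj =>
          intro hj
          have h1 := ihj (by omega)
          have h2 := hcon j (by omega)
          rw [pow_succ]
          nlinarith
      have h1 := hgrow J le_rfl
      have h2 := Finset.sum_le_sum_of_subset_of_nonneg (hsub J) fun x _ _ => hw x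
      linarith
    have hv1 : v ∈ ball (j + 1) :=
      Finset.mem_filter.2 ⟨hv, by rw [hself]; positivity⟩
    have hmono : ball j ⊆ ball (j + 1) := by
      intro x hx
      rw [Finset.mem_filter] at hx ⊢
      refine ⟨hx.1, hx.2.trans ?_⟩
      push_cast
      nlinarith
    obtain ⟨t, hts, c, hc, hclose, hfar, hweight⟩ := ih (s \ ball (j + 1))
      (Finset.sdiff_ssubset (hsub _) ⟨v, hv1⟩)
      ((Finset.sum_le_sum_of_subset_of_nonneg Finset.sdiff_subset fun x _ _ => hw x).trans hs)
    have htball : ∀ x ∈ t, x ∉ ball j := fun x hx hxj =>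
      (Finset.mem_sdiff.1 (hts hx)).2 (hmono hxj)
    have hcv : ∀ x ∈ t, c x ≠ v := fun x hx h =>
      (Finset.mem_sdiff.1 (hc x hx)).2 (h ▸ hv1)
    have hcross : ∀ x ∈ ball j, ∀ y ∈ t, r < δ x y := by
      intro x hx y hy
      have h1 : δ v x ≤ j * r := (Finset.mem_filter.1 hx).2
      have h2 : ¬ δ v y ≤ ((j + 1 : ℕ) : ℝ) * r := fun h =>
        (Finset.mem_sdiff.1 (hts hy)).2
          (Finset.mem_filter.2 ⟨(Finset.mem_sdiff.1 (hts hy)).1, h⟩)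
      push_cast at h2
      linarith [htri v x y]
    -- The inner ball becomes a cluster labelled by its centre and the shell up to `ball (j + 1)` is
    -- discarded, which separates it from the later clusters. Each cluster is charged one seed,
    -- whence the term `s.card * w₀`.
    refine ⟨ball j ∪ t, Finset.union_subset (hsub j) (hts.trans Finset.sdiff_subset),
      fun x => if x ∈ ball j then v else c x, ?_, ?_, ?_, ?_⟩
    · intro x hx
      dsimp only
      split_ifs with h
      · exact hv
      · exact (Finset.mem_sdiff.1 (hc x ((Finset.mem_union.1 hx).resolve_left h))).1
    · intro x hx y hy
      dsimp only
      split_ifs with h1 h2 h2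
      · intro _
        have h3 : δ v x ≤ j * r := (Finset.mem_filter.1 h1).2
        have h4 : δ v y ≤ j * r := (Finset.mem_filter.1 h2).2
        have h5 : (j : ℝ) * r ≤ J * r :=
          mul_le_mul_of_nonneg_right (by exact_mod_cast hjJ.le) hr
        linarith [htri x v y, hsymm x v]
      · exact fun h => absurd h.symm (hcv y ((Finset.mem_union.1 hy).resolve_left h2))
      · exact fun h => absurd h (hcv x ((Finset.mem_union.1 hx).resolve_left h1))
      · exact hclose x ((Finset.mem_union.1 hx).resolve_left h1) y
          ((Finset.mem_union.1 hy).resolve_left h2)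
    · intro x hx y hy
      dsimp only
      split_ifs with h1 h2 h2
      · exact fun h => absurd rfl h
      · exact fun _ => hcross x h1 y ((Finset.mem_union.1 hy).resolve_left h2)
      · intro _
        rw [hsymm]
        exact hcross y h2 x ((Finset.mem_union.1 hx).resolve_left h1)
      · exact hfar x ((Finset.mem_union.1 hx).resolve_left h1) y
          ((Finset.mem_union.1 hy).resolve_left h2)
    · rw [Finset.sum_union (Finset.disjoint_left.2 fun x hx hxt => htball x hxt hx)]
      have hcard : ((s \ ball (j + 1)).card : ℝ) + 1 ≤ s.card := by
        exact_mod_cast Finset.card_lt_card (Finset.sdiff_ssubset (hsub _) ⟨v, hv1⟩)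
      have hsplit := Finset.sum_sdiff (f := w) (hsub (j + 1))
      nlinarith [mul_le_mul_of_nonneg_left
        (mul_le_mul_of_nonneg_right hcard hw₀.le) hε.le]

/-- Every weighted digraph without loops has a directed cut of at least a quarter of its weight. -/
theorem exists_directed_cut {ι κ : Type*} [Fintype ι] [DecidableEq ι] (g : Finset κ) (d : κ → ℝ)
    (a b : κ → ι) (hab : ∀ i ∈ g, a i ≠ b i) :
    ∃ U : Finset ι, ∑ i ∈ g, d i ≤ 4 * ∑ i ∈ g with a i ∈ U ∧ b i ∉ U, d i := by
  let toggle : ι → Equiv.Perm (Finset ι) := fun x =>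
    Function.Involutive.toPerm (fun U => symmDiff U {x}) fun U => by simp
  have htoggle : ∀ x U, toggle x U = symmDiff U {x} := fun _ _ => rfl
  let F : κ → Finset ι → ℝ := fun i U => if a i ∈ U ∧ b i ∉ U then 1 else 0
  have hF : ∀ i ∈ g, 4 * ∑ U, F i U = ∑ _U : Finset ι, (1 : ℝ) := by
    intro i hi
    -- Toggling the two distinct endpoints runs through all four membership patterns, exactly one of
    -- which is cut. This is the computation that a uniformly random `U` cuts each arc with
    -- probability `1/4`.
    have hpt : ∀ U, F i U + F i (toggle (a i) U) + F i (toggle (b i) U) +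
        F i (toggle (b i) (toggle (a i) U)) = 1 := by
      intro U
      have h1 := hab i hi
      have h2 := h1.symm
      by_cases ha : a i ∈ U <;> by_cases hb : b i ∈ U <;>
        simp [F, htoggle, Finset.mem_symmDiff, ha, hb, h1, h2]
    rw [← Finset.sum_congr rfl fun U _ => hpt U]
    simp only [Finset.sum_add_distrib]
    rw [Equiv.sum_comp (toggle (a i)) (F i), Equiv.sum_comp (toggle (b i)) (F i),
      Equiv.sum_comp (toggle (a i)) fun U => F i (toggle (b i) U),
      Equiv.sum_comp (toggle (b i)) (F i)]
    ring
  have htotal : ∑ U : Finset ι, ∑ i ∈ g, d i ≤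
      ∑ U : Finset ι, 4 * ∑ i ∈ g with a i ∈ U ∧ b i ∉ U, d i := by
    refine le_of_eq ?_
    have h1 : ∀ U : Finset ι, 4 * ∑ i ∈ g with a i ∈ U ∧ b i ∉ U, d i =
        ∑ i ∈ g, d i * (4 * F i U) := by
      intro U
      rw [Finset.sum_filter, Finset.mul_sum]
      refine Finset.sum_congr rfl fun i _ => ?_
      simp only [F]
      split_ifs <;> ring
    rw [Finset.sum_congr rfl fun U _ => h1 U, Finset.sum_comm, Finset.sum_comm (s := Finset.univ)]
    refine Finset.sum_congr rfl fun i hi => ?_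
    rw [← Finset.mul_sum, ← Finset.mul_sum, hF i hi, Finset.mul_sum]
    simp
  obtain ⟨U, -, hU⟩ := Finset.exists_le_of_sum_le Finset.univ_nonempty htotal
  exact ⟨U, hU⟩

/-- Among sessions whose endpoints have distance at least `D`, a constant fraction can be chosen
such that each chosen source is far from each chosen sink. -/
theorem exists_separated_sessions {κ X : Type*} [Fintype κ] (δ : X → X → ℝ)
    (hself : ∀ x, δ x x = 0) (hsymm : ∀ x y, δ x y = δ y x)
    (htri : ∀ x y z, δ x z ≤ δ x y + δ y z) (s t : κ → X) (d : κ → ℝ) (hd : ∀ i, 0 < d i)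
    (I : Finset κ) (hI : I.Nonempty) {D : ℝ} (hD : 0 < D) (hfar : ∀ i ∈ I, D ≤ δ (s i) (t i))
    (J : ℕ) (hJ : 2 * (Fintype.card κ : ℝ) + 1 < (9 / 8) ^ J) :
    ∃ I' ⊆ I, ∑ i ∈ I, d i ≤ 8 * ∑ i ∈ I', d i ∧
      ∀ i ∈ I', ∀ j ∈ I', D / (2 * J + 1) < δ (s i) (t j) := by
  classical
  let pos : κ × Bool → X := fun x => if x.2 then s x.1 else t x.1
  have hdI : 0 < ∑ i ∈ I, d i := Finset.sum_pos (fun i _ => hd i) hI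
  have hκ : 0 < (Fintype.card κ : ℝ) := by
    obtain ⟨i, -⟩ := hI
    exact_mod_cast Fintype.card_pos_iff.2 ⟨i⟩
  set w₀ : ℝ := (∑ i ∈ I, d i) / Fintype.card κ with hw₀def
  have hw₀ : 0 < w₀ := by positivity
  have hw₀mul : w₀ * Fintype.card κ = ∑ i ∈ I, d i := div_mul_cancel₀ _ hκ.ne'
  have hr : 0 ≤ D / (2 * J + 1) := by positivity
  have hsum : ∀ f : κ × Bool → ℝ, ∑ x ∈ I ×ˢ (Finset.univ : Finset Bool), f x =
      ∑ i ∈ I, (f (i, true) + f (i, false)) := by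
    intro f
    rw [Finset.sum_product]
    simp
  have hW : ∑ x ∈ I ×ˢ (Finset.univ : Finset Bool), d x.1 = 2 * ∑ i ∈ I, d i := by
    rw [hsum, Finset.mul_sum]
    exact Finset.sum_congr rfl fun i _ => by ring
  obtain ⟨Y, hYs, c, -, hclose, hsep, hweight⟩ := exists_separated_clusters
    (fun x y => δ (pos x) (pos y)) (fun x => hself _) (fun x y => hsymm _ _)
    (fun x y z => htri _ _ _) (fun x => d x.1) (fun x => (hd x.1).le) hw₀
    (ε := 1 / 8) (by norm_num) hr J (W := 2 * ∑ i ∈ I, d i) (by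
      rw [← hw₀mul, show (1 : ℝ) + 1 / 8 = 9 / 8 by norm_num]
      nlinarith) (I ×ˢ Finset.univ) hW.le
  have hcard : ((I ×ˢ (Finset.univ : Finset Bool)).card : ℝ) * w₀ ≤ 2 * ∑ i ∈ I, d i := by
    rw [Finset.card_product, ← hw₀mul]
    have : (I.card : ℝ) ≤ Fintype.card κ := by exact_mod_cast Finset.card_le_univ I
    simp only [Finset.card_univ, Fintype.card_bool, Nat.cast_mul, Nat.cast_ofNat]
    nlinarith
  have hYW : ∑ x ∈ Y, d x.1 ≤ 2 * ∑ i ∈ I, d i :=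
    hW ▸ Finset.sum_le_sum_of_subset_of_nonneg hYs fun x _ _ => (hd x.1).le
  -- These sessions keep both endpoints. The clusters retain weight at least `3/2` of the demand of
  -- `I`, out of `2`, so `g` has at least half of that demand. The directed cut then loses a factor
  -- `4`.
  let g : Finset κ := I.filter fun i => (i, true) ∈ Y ∧ (i, false) ∈ Y
  have hg : ∑ x ∈ Y, d x.1 ≤ ∑ i ∈ I, d i + ∑ i ∈ g, d i := by
    have h1 : ∑ x ∈ Y, d x.1 =
        ∑ x ∈ I ×ˢ (Finset.univ : Finset Bool), if x ∈ Y then d x.1 else 0 := by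
      rw [← Finset.sum_filter]
      refine Finset.sum_congr ?_ fun _ _ => rfl
      ext x
      simpa using fun hx => by simpa using hYs hx
    rw [h1, hsum, Finset.sum_filter, ← Finset.sum_add_distrib]
    refine Finset.sum_le_sum fun i _ => ?_
    have := (hd i).le
    by_cases h2 : (i, true) ∈ Y <;> by_cases h3 : (i, false) ∈ Y <;> simp [h2, h3, this]
  obtain ⟨U, hU⟩ := exists_directed_cut g d (fun i => c (i, true)) (fun i => c (i, false)) (by
    intro i hi heq
    obtain ⟨hiI, h1, h2⟩ := Finset.mem_filter.1 hi
    have h3 := hclose _ h1 _ h2 heq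
    have h4 : D ≤ δ (pos (i, true)) (pos (i, false)) := by simpa [pos] using hfar i hiI
    have h5 : 2 * (J : ℝ) * (D / (2 * J + 1)) < D := by
      rw [mul_div_assoc', div_lt_iff₀ (by positivity)]
      nlinarith
    linarith)
  refine ⟨g.filter fun i => c (i, true) ∈ U ∧ c (i, false) ∉ U,
    (Finset.filter_subset _ _).trans (Finset.filter_subset _ _), by linarith, ?_⟩
  intro i hi j hj
  obtain ⟨hig, hiU, -⟩ := Finset.mem_filter.1 hi
  obtain ⟨hjg, -, hjU⟩ := Finset.mem_filter.1 hj
  have := hsep _ (Finset.mem_filter.1 hig).2.1 _ (Finset.mem_filter.1 hjg).2.2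
    fun h => hjU (h ▸ hiU)
  simpa [pos] using this

theorem exists_growth_exponent {k : ℕ} (hk : 2 ≤ k) :
    ∃ J : ℕ, 2 * (k : ℝ) + 1 < (9 / 8) ^ J ∧ 2 * (J : ℝ) + 1 ≤ 100 * Real.log k := by
  have hk2 : (2 : ℝ) ≤ k := by exact_mod_cast hk
  have hlog2 : 0.6931 < Real.log 2 := by linarith [Real.log_two_gt_d9]
  have hlogk : Real.log 2 ≤ Real.log k := Real.log_le_log two_pos hk2
  -- The factor `8` comes from `2 ≤ (9/8)^8`. The logarithmic bound uses `2k + 1 ≤ k^3`.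
  refine ⟨8 * (Nat.log 2 (2 * k + 1) + 1), ?_, ?_⟩
  · have h1 : ((2 * k + 1 : ℕ) : ℝ) < ((2 ^ (Nat.log 2 (2 * k + 1) + 1) : ℕ) : ℝ) := by
      exact_mod_cast Nat.lt_pow_succ_log_self one_lt_two (2 * k + 1)
    push_cast at h1
    refine h1.trans_le ?_
    rw [pow_mul]
    exact pow_le_pow_left₀ two_pos.le (by norm_num) _
  · have h1 : ((2 ^ Nat.log 2 (2 * k + 1) : ℕ) : ℝ) ≤ ((2 * k + 1 : ℕ) : ℝ) := by
      exact_mod_cast Nat.pow_log_le_self 2 (by omega)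
    push_cast at h1
    have h2 : (2 : ℝ) * k + 1 ≤ (k : ℝ) ^ 3 := by nlinarith [mul_self_nonneg ((k : ℝ) - 2)]
    have h3 := Real.log_le_log (by positivity) (h1.trans h2)
    rw [Real.log_pow, Real.log_pow] at h3
    push_cast at h3 ⊢
    set n : ℝ := (Nat.log 2 (2 * k + 1) : ℝ)
    have hn : 0 ≤ n := Nat.cast_nonneg _
    nlinarith

/-! ### Weighted graph distances -/

section WalkDist

variable {V : Type u} {G : SimpleGraph V} {l : Sym2 V → ℝ}

/-- The distance of two vertices with respect to edge lengths `l`. -/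
def walkDist (G : SimpleGraph V) (l : Sym2 V → ℝ) (x y : V) : ℝ :=
  ⨅ p : G.Walk x y, (p.edges.map l).sum

theorem walkSum_nonneg (hl : ∀ e, 0 ≤ l e) {x y : V} (p : G.Walk x y) :
    0 ≤ (p.edges.map l).sum :=
  List.sum_nonneg fun a ha => by
    obtain ⟨e, -, rfl⟩ := List.mem_map.1 ha
    exact hl e

theorem walkDist_le (hl : ∀ e, 0 ≤ l e) {x y : V} (p : G.Walk x y) :
    walkDist G l x y ≤ (p.edges.map l).sum :=
  ciInf_le ⟨0, by rintro _ ⟨q, rfl⟩; exact walkSum_nonneg hl q⟩ p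

theorem walkDist_self (hl : ∀ e, 0 ≤ l e) (x : V) : walkDist G l x x = 0 := by
  have : Nonempty (G.Walk x x) := ⟨.nil⟩
  exact le_antisymm (by simpa using walkDist_le hl (SimpleGraph.Walk.nil : G.Walk x x))
    (le_ciInf fun p => walkSum_nonneg hl p)

theorem walkDist_comm_le (hG : G.Connected) (hl : ∀ e, 0 ≤ l e) (x y : V) :
    walkDist G l x y ≤ walkDist G l y x := by
  have : Nonempty (G.Walk y x) := hG.preconnected y x
  refine le_ciInf fun p => (walkDist_le hl p.reverse).trans (le_of_eq ?_)
  rw [SimpleGraph.Walk.edges_reverse, List.map_reverse, List.sum_reverse]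

theorem walkDist_comm (hG : G.Connected) (hl : ∀ e, 0 ≤ l e) (x y : V) :
    walkDist G l x y = walkDist G l y x :=
  le_antisymm (walkDist_comm_le hG hl x y) (walkDist_comm_le hG hl y x)

theorem walkDist_triangle (hG : G.Connected) (hl : ∀ e, 0 ≤ l e) (x y z : V) :
    walkDist G l x z ≤ walkDist G l x y + walkDist G l y z := by
  have : Nonempty (G.Walk x y) := hG.preconnected x y
  have : Nonempty (G.Walk y z) := hG.preconnected y z
  refine le_ciInf_add_ciInf fun p q => (walkDist_le hl (p.append q)).trans (le_of_eq ?_)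
  rw [SimpleGraph.Walk.edges_append, List.map_append, List.sum_append]

theorem walkDist_adj_le (hl : ∀ e, 0 ≤ l e) {x y : V} (h : G.Adj x y) :
    walkDist G l x y ≤ l s(x, y) := by
  simpa using walkDist_le hl h.toWalk

theorem le_walkDist_of_forall_path (hG : G.Connected) (hl : ∀ e, 0 ≤ l e) {x y : V} {D : ℝ}
    (h : ∀ p : G.Path x y, D ≤ (p.1.edges.map l).sum) : D ≤ walkDist G l x y := by
  classical
  have : Nonempty (G.Walk x y) := hG.preconnected x y
  refine le_ciInf fun p => (h p.toPath).trans ?_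
  refine List.Sublist.sum_le_sum (p.edges_bypass_sublist_edges.map l) fun a ha => ?_
  obtain ⟨e, -, rfl⟩ := List.mem_map.1 ha
  exact hl e

theorem sum_darts_eq_two_mul [Fintype V] [Fintype G.Dart] [Fintype G.edgeSet]
    (f : G.edgeSet → ℝ) : ∑ a : G.Dart, f ⟨a.edge, a.edge_mem⟩ = 2 * ∑ e, f e := by
  classical
  rw [← Finset.sum_fiberwise Finset.univ (fun a : G.Dart => (⟨a.edge, a.edge_mem⟩ : G.edgeSet)),
    Finset.mul_sum]
  refine Finset.sum_congr rfl fun e _ => ?_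
  rw [Finset.sum_congr rfl fun a ha => by rw [(Finset.mem_filter.1 ha).2], Finset.sum_const,
    nsmul_eq_mul]
  congr 1
  have := G.dart_edge_fiber_card e.1 e.2
  rw [← Nat.cast_ofNat (R := ℝ), Nat.cast_inj, ← this]
  simp only [Subtype.ext_iff]
  congr!

end WalkDist

/-- A crossing round forces `y - x > 1`, hence `q > 1/2`. The number of crossing rounds is less than
`y - x ≤ q + 1/2`, which is then below `2 q`. Thus the additive `1/2` costs only a constant factor,
even on edges with `q = 0`. -/
theorem card_crossing_rounds_le {R : ℕ} {x y q : ℝ} (hq : 0 ≤ q) (hxy : y ≤ x + (q + 1 / 2)) :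
    ((Finset.univ.filter fun r : Fin R => x ≤ (r : ℕ) ∧ ((r : ℕ) : ℝ) + 1 < y).card : ℝ) ≤
      2 * q := by
  set s := Finset.univ.filter fun r : Fin R => x ≤ (r : ℕ) ∧ ((r : ℕ) : ℝ) + 1 < y with hs
  rcases s.eq_empty_or_nonempty with h0 | ⟨r, hr⟩
  · simpa [h0] using hq
  obtain ⟨hxr, hry⟩ := (Finset.mem_filter.1 hr).2
  have hr0 : (0 : ℝ) ≤ (r : ℕ) := Nat.cast_nonneg _
  have hcard : s.card ≤ (Finset.Ico ⌈x⌉₊ (⌈y⌉₊ - 1)).card := by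
    refine Finset.card_le_card_of_injOn (fun r => (r : ℕ)) ?_ fun a _ b _ h => Fin.ext h
    intro a ha
    obtain ⟨h1, h2⟩ := (Finset.mem_filter.1 ha).2
    have h3 : (a : ℕ) + 1 < ⌈y⌉₊ := Nat.lt_ceil.2 (by exact_mod_cast h2)
    exact Finset.mem_coe.2 (Finset.mem_Ico.2 ⟨Nat.ceil_le.2 h1, Nat.lt_sub_of_add_lt h3⟩)
  rw [Nat.card_Ico] at hcard
  have h1 : (r : ℕ) + 1 < ⌈y⌉₊ := Nat.lt_ceil.2 (by exact_mod_cast hry)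
  have h2 : ⌈x⌉₊ ≤ (r : ℕ) := Nat.ceil_le.2 hxr
  have h3 : ((s.card + ⌈x⌉₊ + 1 : ℕ) : ℝ) ≤ (⌈y⌉₊ : ℕ) := by
    exact_mod_cast (by omega : s.card + ⌈x⌉₊ + 1 ≤ ⌈y⌉₊)
  push_cast at h3
  have h4 : (⌈y⌉₊ : ℝ) < y + 1 := Nat.ceil_lt_add_one (by linarith)
  have h5 : x ≤ (⌈x⌉₊ : ℝ) := Nat.le_ceil x
  linarith

/-! ### The makespan bound -/

namespace UnicastInstance

/-- The total capacity of the space-time cut defined by a potential whose variation along each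
edge is bounded by `q e + 1 / 2`. -/
theorem sum_demand_le_of_potential {V : Type u} [Fintype V] {k : ℕ} {M : UnicastInstance V k}
    [Fintype M.graph.edgeSet] {S : MessageSource.{u, v} M} (P : CodingProtocol.{u, v, w} M S)
    {τ : Fin k → ℕ} (hτ : P.HasCompletionTimes τ) (I : Finset (Fin k)) (ρ : V → ℝ)
    (hsource : ∀ i ∈ I, ρ (M.source i) ≤ 0) (hsink : ∀ i ∈ I, (τ i : ℝ) < ρ (M.sink i))
    (q : M.graph.edgeSet → ℝ) (hq : ∀ e, 0 ≤ q e)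
    (hρ : ∀ a : M.graph.Dart, ρ a.snd ≤ ρ a.fst + (q ⟨a.edge, a.edge_mem⟩ + 1 / 2)) :
    ∑ i ∈ I, M.demand i ≤ 4 * ∑ e, M.capacity e * q e := by
  classical
  refine (sum_demand_le_moving_cut P hτ I ρ hsource hsink).trans ?_
  refine le_trans (Finset.sum_le_sum fun a _ => mul_le_mul_of_nonneg_left
    (card_crossing_rounds_le (hq ⟨a.edge, a.edge_mem⟩) (hρ a)) (M.capacity_nonneg _)) ?_
  rw [sum_darts_eq_two_mul fun e => M.capacity e * (2 * q e), Finset.mul_sum, Finset.mul_sum]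
  exact le_of_eq (Finset.sum_congr rfl fun e _ => by ring)

theorem makespan_lower_bound {V : Type u} [Fintype V] {k : ℕ} {M : UnicastInstance V k}
    {T : ℝ} (hT : 0 < T) (hval : M.concurrentFlowValue T < ((1 / 9 : ℝ) : EReal))
    {S : MessageSource.{u, v} M} (P : CodingProtocol.{u, v, w} M S)
    {τ : Fin k → ℕ} (hτ : P.HasCompletionTimes τ) {c : ℝ} (hc : 0 < c)
    (hd : ∀ i, c ≤ M.demand i) (J : ℕ) (hJ : 2 * (k : ℝ) + 1 < (9 / 8) ^ J) :
    T / (4 * (1 + Real.log ((∑ i, M.demand i) / c)) * (2 * J + 1)) ≤ makespan τ := by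
  classical
  obtain ⟨h, l, hh, hl, hpath, hcap, hpos⟩ :=
    M.exists_dual_of_concurrentFlowValue_lt hT.le (by norm_num) hval
  obtain ⟨D, hD, hthr⟩ := exists_threshold M.demand h hc hd hh hpos
  set α := 1 + Real.log ((∑ i, M.demand i) / c) with hαdef
  set I := Finset.univ.filter fun i => D ≤ h i with hIdef
  have hI : I.Nonempty := by
    by_contra h0
    rw [Finset.not_nonempty_iff_eq_empty] at h0
    rw [h0] at hthr
    simp only [Finset.sum_empty, mul_zero, zero_mul] at hthr
    linarith
  have hα : 1 ≤ α := by
    obtain ⟨i, -⟩ := hI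
    have h1 : c ≤ ∑ i, M.demand i := (hd i).trans
      (Finset.single_le_sum (fun i _ => (M.demand_pos i).le) (Finset.mem_univ i))
    have := Real.log_nonneg ((one_le_div hc).2 h1)
    linarith
  let l' : Sym2 V → ℝ := fun e => if he : e ∈ M.graph.edgeSet then l ⟨e, he⟩ else 0
  have hl' : ∀ e, 0 ≤ l' e := fun e => by
    simp only [l']
    split_ifs
    exacts [hl _, le_rfl]
  have hlen : ∀ e, 0 ≤ l' e + D / T := fun e => add_nonneg (hl' e) (by positivity)
  set δ := walkDist M.graph fun e => l' e + D / T with hδ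
  have hfar : ∀ i ∈ I, D ≤ δ (M.source i) (M.sink i) := by
    intro i hi
    refine le_walkDist_of_forall_path M.connected hlen fun p => ?_
    have hsplit : (p.1.edges.map fun e => l' e + D / T).sum =
        (p.1.edges.map l').sum + p.1.length * (D / T) := by
      rw [List.sum_map_add]
      simp
    have hnn : 0 ≤ (p.1.edges.map l').sum := walkSum_nonneg hl' p.1
    rw [hsplit]
    by_cases hp : (p.1.length : ℝ) ≤ T
    · have h1 : D ≤ h i := (Finset.mem_filter.1 hi).2
      have h2 : ∑ e : M.graph.edgeSet with e.1 ∈ p.1.edges, l e ≤ (p.1.edges.map l').sum := by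
        rw [← List.sum_toFinset l' p.2.isTrail.edges_nodup]
        have h3 : ∑ e : M.graph.edgeSet with e.1 ∈ p.1.edges, l e =
            ∑ e ∈ (Finset.univ.filter fun e : M.graph.edgeSet => e.1 ∈ p.1.edges).image
              Subtype.val, l' e := by
          rw [Finset.sum_image fun a _ b _ hab => Subtype.ext hab]
          exact Finset.sum_congr rfl fun e _ => by simp [l']
        rw [h3]
        refine Finset.sum_le_sum_of_subset_of_nonneg (fun e he => ?_) fun e _ _ => hl' e
        obtain ⟨e', he', rfl⟩ := Finset.mem_image.1 he
        exact List.mem_toFinset.2 (Finset.mem_filter.1 he').2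
      have h4 : 0 ≤ (p.1.length : ℝ) * (D / T) := by positivity
      linarith [hpath i p hp]
    · have h1 : T * (D / T) ≤ p.1.length * (D / T) :=
        mul_le_mul_of_nonneg_right (not_le.1 hp).le (by positivity)
      rw [mul_div_cancel₀ _ hT.ne'] at h1
      linarith
  obtain ⟨I', -, hI'd, hsep⟩ := exists_separated_sessions δ (walkDist_self hlen)
    (walkDist_comm M.connected hlen) (walkDist_triangle M.connected hlen) M.source M.sink
    M.demand M.demand_pos I hI hD hfar J (by simpa using hJ)
  have hdI : 0 < ∑ i ∈ I, M.demand i := Finset.sum_pos (fun i _ => M.demand_pos i) hI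
  have hI' : I'.Nonempty := by
    by_contra h0
    rw [Finset.not_nonempty_iff_eq_empty] at h0
    rw [h0, Finset.sum_empty] at hI'd
    linarith
  -- This scaling turns the separation `D / (2 * J + 1)` into the claimed makespan bound, and the
  -- extra length `D / T` into `1 / (4 * α) ≤ 1/2`.
  set θ := T / (4 * α * D) with hθ
  have hθ0 : 0 < θ := by positivity
  by_contra hlt
  push Not at hlt
  have hle := sum_demand_le_of_potential P hτ I'
    (fun v => θ * I'.inf' hI' fun i => δ (M.source i) v)
    (fun i hi => by
      have h1 := Finset.inf'_le (fun j => δ (M.source j) (M.source i)) hi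
      rw [hδ, walkDist_self hlen] at h1
      exact mul_nonpos_of_nonneg_of_nonpos hθ0.le h1)
    (fun j hj => by
      have h1 : (τ j : ℝ) ≤ makespan τ := by
        exact_mod_cast Finset.le_sup (f := τ) (Finset.mem_univ j)
      refine (h1.trans_lt hlt).trans ?_
      have h2 : T / (4 * α * (2 * J + 1)) = θ * (D / (2 * J + 1)) := by
        rw [hθ]
        field_simp
      rw [h2]
      refine mul_lt_mul_of_pos_left ?_ hθ0
      rw [Finset.lt_inf'_iff]
      exact fun i hi => hsep i hi j hj)
    (fun e => θ * l e) (fun e => mul_nonneg hθ0.le (hl e))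
    (fun a => by
      obtain ⟨i, hi, hieq⟩ := Finset.exists_mem_eq_inf' hI' fun i => δ (M.source i) a.fst
      have h1 := Finset.inf'_le (fun i => δ (M.source i) a.snd) hi
      have h2 := walkDist_triangle M.connected hlen (M.source i) a.fst a.snd
      have h3 : δ a.fst a.snd ≤ l ⟨a.edge, a.edge_mem⟩ + D / T := by
        refine (walkDist_adj_le hlen a.adj).trans (le_of_eq ?_)
        have : l' s(a.fst, a.snd) = l ⟨a.edge, a.edge_mem⟩ := dif_pos a.edge_mem
        rw [this]
      have h4 : θ * (D / T) ≤ 1 / 2 := by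
        have : θ * (D / T) = 1 / (4 * α) := by
          rw [hθ]
          field_simp
        rw [this, div_le_div_iff₀ (by positivity) (by norm_num)]
        linarith
      rw [hieq]
      have h5 : θ * (I'.inf' hI' fun i => δ (M.source i) a.snd) ≤
          θ * (δ (M.source i) a.fst + (l ⟨a.edge, a.edge_mem⟩ + D / T)) :=
        mul_le_mul_of_nonneg_left (by linarith) hθ0.le
      linarith)
  have hfac : ∑ e, M.capacity e * (θ * l e) = θ * ∑ e, M.capacity e * l e := by
    rw [Finset.mul_sum]
    exact Finset.sum_congr rfl fun e _ => by ring
  rw [hfac] at hle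
  have hdI' : 0 < ∑ i ∈ I', M.demand i := by linarith
  have h1 : 4 * (θ * ∑ e, M.capacity e * l e) =
      1 / (α * D) * (T * ∑ e, M.capacity e * l e) := by
    rw [hθ]
    field_simp
  have h2 : 1 / (α * D) * (T * ∑ e, M.capacity e * l e) ≤
      1 / (α * D) * (1 / 9 * (D * (8 * ∑ i ∈ I', M.demand i) * α)) := by
    refine mul_le_mul_of_nonneg_left (hcap.trans ?_) (by positivity)
    refine mul_le_mul_of_nonneg_left (hthr.trans ?_) (by norm_num)
    gcongr
  -- The loss `8` in demand is beaten by the dual bound `1/9`; this is where a flow value below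
  -- `1/8` matters.
  have h3 : 1 / (α * D) * (1 / 9 * (D * (8 * ∑ i ∈ I', M.demand i) * α)) =
      8 / 9 * ∑ i ∈ I', M.demand i := by
    field_simp
  linarith

end UnicastInstance
end NetworkCoding

end

/-! ### The universal constant -/

theorem mainTheorem5 :
    ∃ C : ℝ, 0 < C ∧
      ∀ (V : Type u) [Fintype V] (k : ℕ), 2 ≤ k →
      ∀ (M : NetworkCoding.UnicastInstance V k) (T : ℝ), 0 ≤ T →
      M.concurrentFlowValue T ≤ ((1 / 10 : ℝ) : EReal) →
      ∀ (S : NetworkCoding.UnicastInstance.MessageSource.{u, v} M)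
        (P : NetworkCoding.UnicastInstance.CodingProtocol.{u, v, w} M S) (τ : Fin k → ℕ),
      P.HasCompletionTimes τ →
      T / (C * Real.log k * Real.log ((∑ i, M.demand i) / ⨅ i, M.demand i)) ≤
        (NetworkCoding.makespan τ : ℝ) := by
  refine ⟨1200, by norm_num, ?_⟩
  intro V _ k hk M T hT hval S P τ hτ
  -- The case `T = 0` is split off because the proof divides by `T`.
  rcases hT.eq_or_lt with rfl | hT
  · simp
  have : Nonempty (Fin k) := ⟨⟨0, by omega⟩⟩
  obtain ⟨i₀, hi₀⟩ := exists_eq_ciInf_of_finite (f := M.demand)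
  have hd : ∀ i, (⨅ i, M.demand i) ≤ M.demand i := fun i => ciInf_le (Set.finite_range _).bddBelow i
  have hc : 0 < ⨅ i, M.demand i := hi₀ ▸ M.demand_pos i₀
  obtain ⟨J, hJ, hJk⟩ := NetworkCoding.exists_growth_exponent hk
  have hval' : M.concurrentFlowValue T < ((1 / 9 : ℝ) : EReal) :=
    hval.trans_lt (EReal.coe_lt_coe_iff.2 (by norm_num))
  refine le_trans ?_ (NetworkCoding.UnicastInstance.makespan_lower_bound hT hval' P hτ hc hd J hJ)
  set c := ⨅ i, M.demand i
  have hk2 : (2 : ℝ) ≤ k := by exact_mod_cast hk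
  have hsum : k * c ≤ ∑ i, M.demand i := by
    simpa using Finset.card_nsmul_le_sum Finset.univ M.demand c fun i _ => hd i
  have hlog2 : (1 / 2 : ℝ) < Real.log 2 := by linarith [Real.log_two_gt_d9]
  have hL : Real.log 2 ≤ Real.log ((∑ i, M.demand i) / c) := by
    refine Real.log_le_log two_pos ((le_div_iff₀ hc).2 ?_)
    nlinarith
  have hlogk : Real.log 2 ≤ Real.log k := Real.log_le_log two_pos hk2
  set L := Real.log ((∑ i, M.demand i) / c)
  have hL0 : 0 < L := by linarith
  refine div_le_div_of_nonneg_left hT.le (by positivity) ?_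
  -- Since `k ≥ 2`, the demand ratio is at least `2`, so `L > 1/2` and `1 + L ≤ 3 * L`.
  calc 4 * (1 + L) * (2 * (J : ℝ) + 1) ≤ 4 * (3 * L) * (100 * Real.log k) := by
        refine mul_le_mul (by linarith) hJk (by positivity) (by positivity)
    _ = 1200 * Real.log k * L := by ring
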